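/- Let $A,B$ be complex $D\times D$ matrices with $A=A^\dagger$ and $B=B^T$, and let $$\mathsf S=\begin{pmatrix}A&B\\B^*&A^*\end{pmatrix},\qquad \mathsf N=\begin{pmatrix}1&0\\0&-1\end{pmatrix},\qquad \mathsf\Sigma_x=\begin{pmatrix}0&1\\1&0\end{pmatrix},$$ where $^*$ denotes entrywise complex conjugation. A \emph{Jordan basis} of $\mathsf N\mathsf S$ with blocks $(\omega_\nu,d_\nu)_{\nu=1}^m$ (where $d_\nu\ge 1$) is a basis $\{\xi_k^{(\nu)}:1\le\nu\le m,\ 1\le k\le d_\nu\}$ of $\mathbb C^{2D}$ such that $\mathsf S\xi_1^{(\nu)}=\omega_\nu\mathsf N\xi_1^{(\nu)}$ and $\mathsf S\xi_{k+1}^{(\nu)}=\omega_\nu\mathsf N\xi_{k+1}^{(\nu)}+ic_k^{(\nu)}\mathsf N\xi_k^{(\nu)}$ for $1\le k<d_\nu$, with constants $c_k^{(\nu)}\in\mathbb C\setminus\{0\}$. Given a Jordan basis, the LR-dual $\bar\xi_k^{(\nu)}$ of $\xi_k^{(\nu)}$ is the vector, determined up to a phase factor, with $\bigl|\bar\xi_k^{(\nu)\dagger}\mathsf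 N\xi_{k'}^{(\nu')}\bigr|=\delta_{\nu\nu'}\delta_{kk'}$ for all $\nu',k'$. The UL-dual of a vector $x$ is $\mathsf\Sigma_x x^*$. Proposition. The matrix $\mathsf N\mathsf S$ has a Jordan basis. Moreover, whenever $\mathsf N\mathsf S$ has a Jordan basis with blocks $(\omega_\nu,d_\nu)_{\nu=1}^m$, it has a Jordan basis $\{\eta_k^{(\nu)}\}$ with the same blocks in which every even-dimensional block with null eigenvalue is doubly self-dual: for every $\nu$ with $\omega_\nu=0$ and $d_\nu$ even, and every $1\le k\le d_\nu$, $$\mathsf\Sigma_x\,\eta_k^{(\nu)*}=-\eta_k^{(\nu)}\qquad\text{and}\qquad \bar\eta_k^{(\nu)}=\eta_{d_\nu+1-k}^{(\nu)},$$ the second equality being up to a phase factor: $\bigl|\eta_{d_\nu+1-k}^{(\nu)\dagger}\mathsf N\eta_{k'}^{(\nu')}\bigr|=\delta_{\nu\nu'}\delta_{kk'}$ for all basis vectors $\eta_{k'}^{(\nu')}$. -/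

import Mathlib

open scoped Matrix

namespace RPA

variable {n : Type*}

/-- The stability matrix `S = [[A, B], [B*, A*]]`, where `*` is entrywise complex conjugation. -/
def stabilityMatrix (A B : Matrix n n ℂ) : Matrix (n ⊕ n) (n ⊕ n) ℂ :=
  Matrix.fromBlocks A B (B.map (starRingEnd ℂ)) (A.map (starRingEnd ℂ))

/-- The norm matrix `N = [[1, 0], [0, -1]]`. -/
def normMatrix (n : Type*) [DecidableEq n] : Matrix (n ⊕ n) (n ⊕ n) ℂ :=
  Matrix.fromBlocks 1 0 0 (-1)

/-- The matrix `Σ_x = [[0, 1], [1, 0]]`. -/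
def sigmaX (n : Type*) [DecidableEq n] : Matrix (n ⊕ n) (n ⊕ n) ℂ :=
  Matrix.fromBlocks 0 1 1 0

variable [Fintype n] [DecidableEq n]

/-- The UL-dual `Σ_x x*` of a vector `x`, where `x*` is the entrywise complex conjugate. -/
def ulDual (x : n ⊕ n → ℂ) : n ⊕ n → ℂ :=
  sigmaX n *ᵥ star x

/-- The overlap `x† N y`. -/
def overlap (x y : n ⊕ n → ℂ) : ℂ :=
  star x ⬝ᵥ (normMatrix n *ᵥ y)

/-- A complete set of basis vectors of `N S` consisting of `m` Jordan blocks. The `ν`-th block has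
eigenvalue `ω ν`, dimension `d ν ≥ 1`, and basis vectors `basis ⟨ν, k⟩`, numbered here from `k = 0`,
with `S ξ₀ = ω N ξ₀` and `S ξ_{k+1} = ω N ξ_{k+1} + i c_k N ξ_k`, `c_k ≠ 0`. -/
structure JordanBasis (A B : Matrix n n ℂ) {m : ℕ} (ω : Fin m → ℂ) (d : Fin m → ℕ) where
  basis : Module.Basis (Σ ν : Fin m, Fin (d ν)) ℂ (n ⊕ n → ℂ)
  c : Fin m → ℕ → ℂ
  dim_pos : ∀ ν, 0 < d ν
  c_ne_zero : ∀ ν k, k + 1 < d ν → c ν k ≠ 0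
  eigenvector : ∀ ν,
    stabilityMatrix A B *ᵥ basis ⟨ν, ⟨0, dim_pos ν⟩⟩ =
      ω ν • (normMatrix n *ᵥ basis ⟨ν, ⟨0, dim_pos ν⟩⟩)
  chain : ∀ ν k (h : k + 1 < d ν),
    stabilityMatrix A B *ᵥ basis ⟨ν, ⟨k + 1, h⟩⟩ =
      ω ν • (normMatrix n *ᵥ basis ⟨ν, ⟨k + 1, h⟩⟩) +
        (Complex.I * c ν k) • (normMatrix n *ᵥ basis ⟨ν, ⟨k, Nat.lt_of_succ_lt h⟩⟩)

/-- `y` is (up to a phase) the LR-dual of the basis vector `ξ_k^{(ν)}` within the complete set `J`: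
`|y† N ξ_{k'}^{(ν')}| = δ_{νν'} δ_{kk'}` for all basis vectors `ξ_{k'}^{(ν')}` of `J`. -/
def JordanBasis.IsLRDual {A B : Matrix n n ℂ} {m : ℕ} {ω : Fin m → ℂ} {d : Fin m → ℕ}
    (J : JordanBasis A B ω d) (ν : Fin m) (k : Fin (d ν)) (y : n ⊕ n → ℂ) : Prop :=
  ‖overlap y (J.basis ⟨ν, k⟩)‖ = 1 ∧
    ∀ p : Σ ν' : Fin m, Fin (d ν'), p ≠ ⟨ν, k⟩ → overlap y (J.basis p) = 0

end RPA

/-! With `T = -i N S`, the form `h x y = x† N y` and the antilinear involution `κ x = -Σ_x x*`, the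
operator is skew-adjoint for `h` and commutes with `κ`, while `h (κ x) (κ y)` is minus the conjugate
of `h x y`. The theorem is thus a statement about the normal form of a real Hamiltonian operator at
eigenvalue zero; the doubly self-dual blocks are chains generated by a real vector (`κ v = v`) and
pairing with themselves.

Parity decides everything. On real vectors `h x (T ^ j y)` is symmetric in `x, y` for odd `j` and
alternating for even `j` (`swap`). A longest nilpotent chain has top pairing `T ^ D`, with length `D
+ 1`. If the length is even, polarization yields a real vector with nonzero top self-pairing; adding
real multiples of its iterates kills the lower pairings (`exists_real_antidiagonal`), and a real
rescaling normalizes it. If the length is odd, self-pairings vanish and two chains are split off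
together. In both cases the remaining complement is orthogonal to what was removed, nondegenerate
and stable under `T` and `κ`, so induction on dimension applies (`exists_isChainBasis_nilpotent`).

The Fitting decomposition at `0` is orthogonal by skewness, so the invertible part can be given any
Jordan basis. Uniqueness of block data (`exists_equiv`) then matches the basis so built with the
prescribed blocks. -/

namespace Module.End

/-! ### Jordan chains, splitting off one chain, and existence of the Jordan form -/

section Chains

variable {K V : Type*} [Field K] [AddCommGroup V] [Module K V]

/-- The vectors `(T - τ i) ^ k (v i)`, `k < d i`, of the Jordan chains generated by `v i`. -/
def chainFamily (T : End K V) {ι : Type*} (τ : ι → K) (d : ι → ℕ) (v : ι → V) :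
    (Σ i, Fin (d i)) → V :=
  fun p => ((T - algebraMap K (End K V) (τ p.1)) ^ (p.2 : ℕ)) (v p.1)

/-- The Jordan chains of `T` generated by the vectors `v i`, with eigenvalues `τ i` and lengths
`d i`, form a basis of `W`. -/
structure IsChainBasis (T : End K V) (W : Submodule K V) {ι : Type*} (τ : ι → K) (d : ι → ℕ)
    (v : ι → V) : Prop where
  pos : ∀ i, 0 < d i
  pow_eq_zero : ∀ i, ((T - algebraMap K (End K V) (τ i)) ^ d i) (v i) = 0
  linearIndependent : LinearIndependent K (chainFamily T τ d v)
  span_eq : Submodule.span K (Set.range (chainFamily T τ d v)) = W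

theorem isChainBasis_bot (T : End K V) (τ : Empty → K) (d : Empty → ℕ) (v : Empty → V) :
    IsChainBasis T ⊥ τ d v where
  pos i := i.elim
  pow_eq_zero i := i.elim
  linearIndependent := linearIndependent_empty_type
  span_eq := by simp

theorem IsChainBasis.sum {T : End K V} {W W' : Submodule K V} {ι ι' : Type*}
    {τ : ι → K} {d : ι → ℕ} {v : ι → V} {τ' : ι' → K} {d' : ι' → ℕ} {v' : ι' → V}
    (h : IsChainBasis T W τ d v) (h' : IsChainBasis T W' τ' d' v') (hW : Disjoint W W') :
    IsChainBasis T (W ⊔ W') (Sum.elim τ τ') (Sum.elim d d') (Sum.elim v v') := by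
  obtain ⟨e, key⟩ : ∃ e : (Σ i, Fin (Sum.elim d d' i)) ≃ (Σ i, Fin (d i)) ⊕ Σ i, Fin (d' i),
      chainFamily T (Sum.elim τ τ') (Sum.elim d d') (Sum.elim v v') =
        Sum.elim (chainFamily T τ d v) (chainFamily T τ' d' v') ∘ e := by
    refine ⟨Equiv.sumSigmaDistrib (fun i => Fin (Sum.elim d d' i)), ?_⟩
    funext ⟨i, k⟩
    cases i <;> rfl
  refine ⟨?_, ?_, ?_, ?_⟩
  · rintro (i | i)
    exacts [h.pos i, h'.pos i]
  · rintro (i | i)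
    exacts [h.pow_eq_zero i, h'.pow_eq_zero i]
  · rw [key, linearIndependent_equiv]
    refine h.linearIndependent.sum_type h'.linearIndependent ?_
    rwa [h.span_eq, h'.span_eq]
  · rw [key, (Equiv.surjective _).range_comp, Set.Sum.elim_range, Submodule.span_union, h.span_eq,
      h'.span_eq]

theorem IsChainBasis.reindex {T : End K V} {W : Submodule K V} {ι ι' : Type*}
    {τ : ι → K} {d : ι → ℕ} {v : ι → V} (h : IsChainBasis T W τ d v) (e : ι' ≃ ι) :
    IsChainBasis T W (τ ∘ e) (d ∘ e) (v ∘ e) := by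
  have key : chainFamily T (τ ∘ e) (d ∘ e) (v ∘ e) =
      chainFamily T τ d v ∘ Equiv.sigmaCongrLeft (β := fun i => Fin (d i)) e := by
    funext ⟨i, k⟩
    rfl
  refine ⟨fun i => h.pos _, fun i => h.pow_eq_zero _, ?_, ?_⟩
  · rw [key, linearIndependent_equiv]
    exact h.linearIndependent
  · rw [key, (Equiv.surjective _).range_comp, h.span_eq]

theorem IsChainBasis.mem {T : End K V} {W : Submodule K V} {ι : Type*}
    {τ : ι → K} {d : ι → ℕ} {v : ι → V} (h : IsChainBasis T W τ d v) (i : ι) : v i ∈ W := by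
  rw [← h.span_eq]
  exact Submodule.subset_span ⟨⟨i, ⟨0, h.pos i⟩⟩, by simp [chainFamily]⟩

theorem IsChainBasis.ne_zero {T : End K V} {W : Submodule K V} {ι : Type*}
    {τ : ι → K} {d : ι → ℕ} {v : ι → V} (h : IsChainBasis T W τ d v) (i : ι) {k : ℕ}
    (hk : k < d i) : ((T - algebraMap K (End K V) (τ i)) ^ k) (v i) ≠ 0 :=
  h.linearIndependent.ne_zero (⟨i, ⟨k, hk⟩⟩ : Σ i, Fin (d i))

theorem pow_apply_mem {g : End K V} {W : Submodule K V} (hW : ∀ x ∈ W, g x ∈ W) (k : ℕ) {x : V}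
    (hx : x ∈ W) : (g ^ k) x ∈ W := by
  induction k with
  | zero => simpa
  | succ k ih => rw [pow_succ', Module.End.mul_apply]; exact hW _ ih

theorem sub_algebraMap_apply_mem {T : End K V} {W : Submodule K V} (hW : ∀ x ∈ W, T x ∈ W) (τ : K)
    {x : V} (hx : x ∈ W) : (T - algebraMap K (End K V) τ) x ∈ W := by
  simpa [Module.algebraMap_end_apply] using W.sub_mem (hW x hx) (W.smul_mem τ hx)

theorem pow_apply_eq_zero_of_le {g : End K V} {x : V} {d k : ℕ} (h : (g ^ d) x = 0) (hk : d ≤ k) :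
    (g ^ k) x = 0 := by
  rw [← Nat.sub_add_cancel hk, pow_add, Module.End.mul_apply, h, map_zero]

/-- The vectors of `W` all of whose iterates under `g` are annihilated by `φ`. -/
def chainCompl (g : End K V) (φ : V →ₗ[K] K) (W : Submodule K V) : Submodule K V :=
  W ⊓ ⨅ j : ℕ, LinearMap.ker (φ ∘ₗ g ^ j)

theorem mem_chainCompl {g : End K V} {φ : V →ₗ[K] K} {W : Submodule K V} {x : V} :
    x ∈ chainCompl g φ W ↔ x ∈ W ∧ ∀ j : ℕ, φ ((g ^ j) x) = 0 := by
  simp [chainCompl]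

theorem chainCompl_invariant {g : End K V} {φ : V →ₗ[K] K} {W : Submodule K V}
    (hW : ∀ x ∈ W, g x ∈ W) : ∀ x ∈ chainCompl g φ W, g x ∈ chainCompl g φ W := by
  intro x hx
  rw [mem_chainCompl] at hx ⊢
  refine ⟨hW x hx.1, fun j => ?_⟩
  have := hx.2 (j + 1)
  rwa [pow_succ, Module.End.mul_apply] at this

variable {g : End K V} {φ : V →ₗ[K] K} {v : V} {d : ℕ}

/-- Pairing the iterates of a combination of a Jordan chain with a functional that does not vanish
at the end of the chain determines the coefficients. -/
theorem chain_coeff_eq_zero (hv : (g ^ d) v = 0) (hφ : φ ((g ^ (d - 1)) v) ≠ 0)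
    (a : Fin d → K)
    (h : ∀ j < d, φ ((g ^ j) (∑ k : Fin d, a k • (g ^ (k : ℕ)) v)) = 0) : a = 0 := by
  have main : ∀ (n : ℕ) (hn : n < d), a ⟨n, hn⟩ = 0 := by
    intro n
    induction n using Nat.strong_induction_on with
    | _ n ih =>
      intro hn
      have h1 := h (d - 1 - n) (by omega)
      rw [map_sum, map_sum, Finset.sum_eq_single ⟨n, hn⟩] at h1
      · rw [map_smul, map_smul, ← Module.End.mul_apply, ← pow_add, smul_eq_mul,
          show d - 1 - n + n = d - 1 by omega] at h1
        exact (mul_eq_zero.1 h1).resolve_right hφ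
      · rintro ⟨k, hk⟩ - hne
        have hne' : k ≠ n := fun e => hne (by simp [e])
        rcases lt_or_gt_of_ne hne' with hlt | hgt
        · rw [ih k hlt hk]; simp
        · rw [map_smul, ← Module.End.mul_apply, ← pow_add,
            pow_apply_eq_zero_of_le hv (by simp only; omega)]
          simp
      · simp
  funext ⟨n, hn⟩
  exact main n hn

theorem chain_linearIndependent (hv : (g ^ d) v = 0) (hφ : φ ((g ^ (d - 1)) v) ≠ 0) :
    LinearIndependent K (fun k : Fin d => (g ^ (k : ℕ)) v) := by
  rw [Fintype.linearIndependent_iff]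
  intro a ha i
  rw [chain_coeff_eq_zero hv hφ a (by simp [ha])]
  rfl

theorem chain_disjoint (hv : (g ^ d) v = 0) (hφ : φ ((g ^ (d - 1)) v) ≠ 0) (W : Submodule K V) :
    Disjoint (Submodule.span K (Set.range fun k : Fin d => (g ^ (k : ℕ)) v))
      (chainCompl g φ W) := by
  rw [Submodule.disjoint_def]
  intro x hx hx'
  obtain ⟨a, rfl⟩ := (Submodule.mem_span_range_iff_exists_fun K).1 hx
  rw [mem_chainCompl] at hx'
  rw [chain_coeff_eq_zero hv hφ a fun j _ => hx'.2 j]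
  simp

/-- The square linear system for the coefficients of a chain combination with prescribed values `φ
(g ^ j ·)`, `j < d`, is injective, hence solvable. Subtracting the combination with the values of
`x` leaves a vector in `chainCompl`; the exponents `j ≥ d` are covered by `hφW`. -/
theorem chain_sup (hv : (g ^ d) v = 0) (hφ : φ ((g ^ (d - 1)) v) ≠ 0) {W : Submodule K V}
    (hW : ∀ x ∈ W, g x ∈ W) (hvW : v ∈ W) (hφW : ∀ x ∈ W, φ ((g ^ d) x) = 0) :
    Submodule.span K (Set.range fun k : Fin d => (g ^ (k : ℕ)) v) ⊔ chainCompl g φ W = W := by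
  apply le_antisymm
  · refine sup_le (Submodule.span_le.2 ?_) inf_le_left
    rintro _ ⟨k, rfl⟩
    exact pow_apply_mem hW _ hvW
  · intro x hx
    let Ψ : (Fin d → K) →ₗ[K] (Fin d → K) := LinearMap.pi fun j =>
      φ ∘ₗ (g ^ (j : ℕ)) ∘ₗ Fintype.linearCombination K (fun k : Fin d => (g ^ (k : ℕ)) v)
    have hΨ : Function.Injective Ψ := by
      rw [injective_iff_map_eq_zero]
      intro a ha
      refine chain_coeff_eq_zero hv hφ a fun j hj => ?_
      simpa [Ψ, Fintype.linearCombination_apply] using congrFun ha ⟨j, hj⟩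
    obtain ⟨a, ha⟩ := LinearMap.injective_iff_surjective.1 hΨ (fun j => φ ((g ^ (j : ℕ)) x))
    have hmem : ∑ k : Fin d, a k • (g ^ (k : ℕ)) v ∈
        Submodule.span K (Set.range fun k : Fin d => (g ^ (k : ℕ)) v) :=
      (Submodule.mem_span_range_iff_exists_fun K).2 ⟨a, rfl⟩
    refine Submodule.mem_sup.2 ⟨_, hmem, x - ∑ k : Fin d, a k • (g ^ (k : ℕ)) v, ?_, by abel⟩
    have hsub : x - ∑ k : Fin d, a k • (g ^ (k : ℕ)) v ∈ W :=
      W.sub_mem hx (W.sum_mem fun k _ => W.smul_mem _ (pow_apply_mem hW _ hvW))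
    refine mem_chainCompl.2 ⟨hsub, fun j => ?_⟩
    rcases lt_or_ge j d with hj | hj
    · have := congrFun ha ⟨j, hj⟩
      simp only [Ψ, LinearMap.pi_apply, LinearMap.comp_apply,
        Fintype.linearCombination_apply] at this
      rw [map_sub, map_sub, this, sub_self]
    · rw [← Nat.add_sub_cancel' hj, pow_add, Module.End.mul_apply]
      exact hφW _ (pow_apply_mem hW _ hsub)

theorem isChainBasis_chain {T : End K V} {τ : K} (hd : 0 < d)
    (hv : ((T - algebraMap K (End K V) τ) ^ d) v = 0)
    (hφ : φ (((T - algebraMap K (End K V) τ) ^ (d - 1)) v) ≠ 0) :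
    IsChainBasis T (Submodule.span K
        (Set.range fun k : Fin d => ((T - algebraMap K (End K V) τ) ^ (k : ℕ)) v))
      (fun _ : Unit => τ) (fun _ => d) (fun _ => v) := by
  have key : chainFamily T (fun _ : Unit => τ) (fun _ => d) (fun _ => v) =
      (fun k : Fin d => ((T - algebraMap K (End K V) τ) ^ (k : ℕ)) v) ∘
        Equiv.uniqueSigma (fun _ : Unit => Fin d) := by
    funext ⟨i, k⟩
    rfl
  refine ⟨fun _ => hd, fun _ => hv, ?_, ?_⟩
  · rw [key, linearIndependent_equiv]
    exact chain_linearIndependent hv hφ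
  · rw [key, (Equiv.surjective _).range_comp]

theorem finrank_chainCompl_lt [FiniteDimensional K V] {W : Submodule K V} (hvW : v ∈ W)
    (hφ : φ ((g ^ (d - 1)) v) ≠ 0) :
    Module.finrank K (chainCompl g φ W) < Module.finrank K W := by
  refine Submodule.finrank_lt_finrank_of_lt (lt_of_le_of_ne inf_le_left fun h => hφ ?_)
  rw [← h, mem_chainCompl] at hvW
  exact hvW.2 _

/-- Jordan normal form of an endomorphism restricted to an invariant subspace. -/
theorem exists_isChainBasis [IsAlgClosed K] [FiniteDimensional K V] (T : End K V)
    (W : Submodule K V) (hW : ∀ x ∈ W, T x ∈ W) :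
    ∃ (ι : Type) (_ : Fintype ι) (τ : ι → K) (d : ι → ℕ) (v : ι → V), IsChainBasis T W τ d v := by
  induction hn : Module.finrank K W using Nat.strong_induction_on generalizing W with
  | _ n ih =>
    subst hn
    rcases eq_or_ne W ⊥ with rfl | hne
    · exact ⟨Empty, inferInstance, Empty.elim, Empty.elim, Empty.elim, isChainBasis_bot T _ _ _⟩
    have : Nontrivial W := Submodule.nontrivial_iff_ne_bot.2 hne
    obtain ⟨τ, hτ⟩ := Module.End.exists_eigenvalue (T.restrict hW)
    obtain ⟨⟨u, huW⟩, hu⟩ := hτ.exists_hasEigenvector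
    have hu0 : u ≠ 0 := fun h => hu.2 (by simp [h])
    have huT : T u = τ • u := congrArg Subtype.val hu.apply_eq_smul
    set g := T - algebraMap K (End K V) τ with hg
    have hgW : ∀ x ∈ W, g x ∈ W := fun x hx => sub_algebraMap_apply_mem hW τ hx
    have hgu : g u = 0 := by simp [hg, Module.algebraMap_end_apply, huT]
    have hex : ∃ n, ∀ x ∈ W, (∃ k, (g ^ k) x = 0) → (g ^ n) x = 0 := by
      refine ⟨Module.finrank K V, fun x _ ⟨k, hk⟩ => ?_⟩
      have h1 : x ∈ g.maxGenEigenspace 0 := by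
        rw [Module.End.mem_maxGenEigenspace]; exact ⟨k, by simpa using hk⟩
      rw [Module.End.maxGenEigenspace_eq_genEigenspace_finrank,
        Module.End.mem_genEigenspace_nat] at h1
      simpa using h1
    classical
    obtain ⟨d, hd, hmin⟩ : ∃ d, (∀ x ∈ W, (∃ k, (g ^ k) x = 0) → (g ^ d) x = 0) ∧
        ∀ m < d, ¬ ∀ x ∈ W, (∃ k, (g ^ k) x = 0) → (g ^ m) x = 0 :=
      ⟨Nat.find hex, Nat.find_spec hex, fun m hm => Nat.find_min hex hm⟩
    have hd0 : 0 < d := by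
      rcases Nat.eq_zero_or_pos d with rfl | h
      · exact absurd (by simpa using hd u huW ⟨1, by simpa using hgu⟩) hu0
      · exact h
    have h2 := hmin (d - 1) (by omega)
    push Not at h2
    obtain ⟨v, hvW, hvk, hv⟩ := h2
    have hvd := hd v hvW hvk
    -- Maximality of `d`: a preimage `y` would be killed by `g ^ (d + 1)`, hence already by `g ^ d`.
    -- A functional separating this vector from `g ^ d W` is what the splitting of the chain
    -- requires.
    have hnot : (g ^ (d - 1)) v ∉ W.map (g ^ d) := by
      rintro ⟨y, hy, hyv⟩
      have h3 : (g ^ (d + 1)) y = 0 := by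
        rw [pow_succ', Module.End.mul_apply, hyv, ← Module.End.mul_apply, ← pow_succ',
          Nat.sub_add_cancel hd0, hvd]
      exact hv (hyv ▸ hd y hy ⟨_, h3⟩)
    obtain ⟨φ, hφ, hφW⟩ := Submodule.exists_le_ker_of_notMem hnot
    have hφW' : ∀ x ∈ W, φ ((g ^ d) x) = 0 := fun x hx => hφW (Submodule.mem_map_of_mem hx)
    have hTc : ∀ x ∈ chainCompl g φ W, T x ∈ chainCompl g φ W := by
      intro x hx
      have h4 := Submodule.add_mem _ (chainCompl_invariant hgW x hx) (Submodule.smul_mem _ τ hx)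
      simpa [hg, Module.algebraMap_end_apply] using h4
    obtain ⟨ι, _, τ', d', v', h'⟩ := ih _ (finrank_chainCompl_lt hvW hφ) (chainCompl g φ W) hTc rfl
    have := (isChainBasis_chain hd0 hvd hφ).sum h' (chain_disjoint hvd hφ W)
    rw [chain_sup hvd hφ hgW hvW hφW'] at this
    exact ⟨Unit ⊕ ι, inferInstance, _, _, _, this⟩

end Chains

/-! ### Uniqueness of the eigenvalues and block lengths -/

section Uniqueness

variable {K V : Type*} [Field K] [AddCommGroup V] [Module K V]
  {T : End K V} {ι : Type*} {τ : ι → K} {d : ι → ℕ} {v : ι → V}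

theorem chainFamily_mem_maxGenEigenspace
    (h : ∀ i, ((T - algebraMap K (End K V) (τ i)) ^ d i) (v i) = 0)
    (p : Σ i, Fin (d i)) : chainFamily T τ d v p ∈ T.maxGenEigenspace (τ p.1) := by
  rw [Module.End.mem_maxGenEigenspace]
  refine ⟨d p.1, ?_⟩
  rw [← Algebra.algebraMap_eq_smul_one, chainFamily, ← Module.End.mul_apply, ← pow_add]
  exact pow_apply_eq_zero_of_le (h p.1) (Nat.le_add_right _ _)

/-- Chains with other eigenvalues lie in the sum of the other generalized eigenspaces, which is
independent of this one; the modular law then leaves only the chains at `a`. -/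
theorem IsChainBasis.maxGenEigenspace_eq (h : IsChainBasis T ⊤ τ d v) (a : K) :
    T.maxGenEigenspace a = Submodule.span K (chainFamily T τ d v '' {p | τ p.1 = a}) := by
  set V₁ := Submodule.span K (chainFamily T τ d v '' {p | τ p.1 = a})
  set V₂ := Submodule.span K (chainFamily T τ d v '' {p | τ p.1 = a}ᶜ)
  have h₁ : V₁ ≤ T.maxGenEigenspace a := by
    refine Submodule.span_le.2 ?_
    rintro _ ⟨p, hp, rfl⟩
    rw [← (show τ p.1 = a from hp)]
    exact chainFamily_mem_maxGenEigenspace h.pow_eq_zero p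
  have h₂ : V₂ ≤ ⨆ (b : K) (_ : b ≠ a), T.maxGenEigenspace b := by
    refine Submodule.span_le.2 ?_
    rintro _ ⟨p, hp, rfl⟩
    exact Submodule.mem_iSup_of_mem (τ p.1) (Submodule.mem_iSup_of_mem hp
      (chainFamily_mem_maxGenEigenspace h.pow_eq_zero p))
  have hd := (T.independent_maxGenEigenspace a).mono_right h₂
  have htop : V₁ ⊔ V₂ = ⊤ := by
    rw [← Submodule.span_union, ← Set.image_union, Set.union_compl_self, Set.image_univ, h.span_eq]
  calc T.maxGenEigenspace a = (V₁ ⊔ V₂) ⊓ T.maxGenEigenspace a := by rw [htop, top_inf_eq]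
    _ = V₁ ⊔ V₂ ⊓ T.maxGenEigenspace a := sup_inf_assoc_of_le _ h₁
    _ = V₁ := by rw [inf_comm, hd.eq_bot, sup_bot_eq]

/-- The power `j` drops the first `j` vectors of each chain at `a`, so `d i - j` (truncated)
survive. The left side does not depend on the chosen chains. -/
theorem IsChainBasis.finrank_map [Fintype ι] [DecidableEq K] (h : IsChainBasis T ⊤ τ d v) (a : K)
    (j : ℕ) :
    Module.finrank K ((T.maxGenEigenspace a).map ((T - algebraMap K (End K V) a) ^ j)) =
      ∑ i with τ i = a, (d i - j) := by
  let F : (Σ i : {i // τ i = a}, Fin (d i - j)) → Σ i, Fin (d i) := fun p =>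
    ⟨p.1, ⟨p.2 + j, by omega⟩⟩
  have hF : Function.Injective F := by
    rintro ⟨⟨i, hi⟩, k, hk⟩ ⟨⟨i', hi'⟩, k', hk'⟩ hp
    simp only [F, Sigma.mk.injEq] at hp
    obtain ⟨rfl, hp⟩ := hp
    simp only [heq_eq_eq, Fin.mk.injEq, add_left_inj] at hp
    subst hp
    rfl
  have hspan : (T.maxGenEigenspace a).map ((T - algebraMap K (End K V) a) ^ j) =
      Submodule.span K (Set.range (chainFamily T τ d v ∘ F)) := by
    rw [h.maxGenEigenspace_eq a, Submodule.map_span]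
    apply le_antisymm <;> refine Submodule.span_le.2 ?_
    · rintro _ ⟨_, ⟨⟨i, k, hk⟩, hp, rfl⟩, rfl⟩
      have hp : τ i = a := hp
      subst hp
      simp only [chainFamily, ← Module.End.mul_apply, ← pow_add]
      rcases lt_or_ge (j + k) (d i) with hlt | hge
      · refine Submodule.subset_span ⟨⟨⟨i, rfl⟩, ⟨k, by simp only; omega⟩⟩, ?_⟩
        simp only [Function.comp_apply, F, chainFamily, add_comm]
      · rw [pow_apply_eq_zero_of_le (h.pow_eq_zero i) hge]
        exact Submodule.zero_mem _
    · rintro _ ⟨⟨⟨i, hi⟩, k, hk⟩, rfl⟩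
      subst hi
      refine Submodule.subset_span ⟨_, ⟨⟨i, ⟨k, by simp only at hk; omega⟩⟩, rfl, rfl⟩, ?_⟩
      simp only [Function.comp_apply, F, chainFamily, ← Module.End.mul_apply, ← pow_add, add_comm]
  have hsum : ∑ i with τ i = a, (d i - j) = ∑ i : {i // τ i = a}, (d i - j) :=
    Finset.sum_subtype _ (by simp) _
  rw [hspan, finrank_span_eq_card (h.linearIndependent.comp F hF), Fintype.card_sigma, hsum]
  simp

/-- The second difference in `j` of the truncated `d - j` is the indicator of `d = j + 1`. It is
written additively to avoid truncation. -/
theorem IsChainBasis.card_blocks [Fintype ι] [DecidableEq K] (h : IsChainBasis T ⊤ τ d v) (a : K)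
    (j : ℕ) :
    (∑ i with τ i = a, (d i - j)) + (∑ i with τ i = a, (d i - (j + 2))) =
      2 * (∑ i with τ i = a, (d i - (j + 1))) +
        Fintype.card {i // (τ i, d i) = (a, j + 1)} := by
  rw [Fintype.card_subtype, Finset.card_filter, Finset.mul_sum]
  simp only [Finset.sum_filter, ← Finset.sum_add_distrib]
  refine Finset.sum_congr rfl fun i _ => ?_
  have := h.pos i
  by_cases h1 : τ i = a <;> by_cases h2 : d i = j + 1 <;> (simp [h1, h2]; try omega)

/-- The eigenvalues and lengths of the Jordan chains are determined by the endomorphism. -/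
theorem IsChainBasis.exists_equiv [Fintype ι] {ι' : Type*} [Fintype ι'] {τ' : ι' → K}
    {d' : ι' → ℕ} {v' : ι' → V} (h : IsChainBasis T ⊤ τ d v) (h' : IsChainBasis T ⊤ τ' d' v') :
    ∃ e : ι ≃ ι', τ' ∘ e = τ ∧ d' ∘ e = d := by
  classical
  have hcard : ∀ y : K × ℕ,
      Fintype.card {i // (τ i, d i) = y} = Fintype.card {i // (τ' i, d' i) = y} := by
    rintro ⟨a, _ | j⟩
    · have : IsEmpty {i // (τ i, d i) = (a, 0)} :=
        ⟨fun i => (h.pos i.1).ne' (Prod.ext_iff.1 i.2).2⟩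
      have : IsEmpty {i // (τ' i, d' i) = (a, 0)} :=
        ⟨fun i => (h'.pos i.1).ne' (Prod.ext_iff.1 i.2).2⟩
      simp only [Fintype.card_eq_zero]
    · have h1 := h.card_blocks a j
      have h2 := h'.card_blocks a j
      simp only [← h.finrank_map, ← h'.finrank_map] at h1 h2
      omega
  let e : ι ≃ ι' := (Equiv.sigmaFiberEquiv fun i => (τ i, d i)).symm.trans
    ((Equiv.sigmaCongrRight fun y => Fintype.equivOfCardEq (hcard y)).trans
      (Equiv.sigmaFiberEquiv fun i => (τ' i, d' i)))
  have he : ∀ i, (τ' (e i), d' (e i)) = (τ i, d i) := fun i =>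
    (Fintype.equivOfCardEq (hcard (τ i, d i)) ⟨i, rfl⟩).2
  exact ⟨e, funext fun i => (Prod.ext_iff.1 (he i)).1, funext fun i => (Prod.ext_iff.1 (he i)).2⟩

end Uniqueness

open scoped ComplexConjugate

/-! ### Real Hamiltonian operators: parity of pairings and self-dual generators -/

section RealSkew

variable {V : Type*} [AddCommGroup V] [Module ℂ V]

/-- `h` is a Hermitian form, `κ` an antilinear involution with `h (κ x) (κ y) = -conj (h x y)`, and
`T` commutes with `κ` and is skew-adjoint for `h`: on the real subspace of fixed points of `κ`, the
form `h` is `I` times a real alternating form and `T` is a Hamiltonian operator. -/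
structure IsRealSkew (h : V →ₗ⋆[ℂ] V →ₗ[ℂ] ℂ) (κ : V →ₗ⋆[ℂ] V) (T : End ℂ V) : Prop where
  symm : ∀ x y, h y x = conj (h x y)
  conj_conj : ∀ x y, h (κ x) (κ y) = -conj (h x y)
  invol : ∀ x, κ (κ x) = x
  comm : ∀ x, κ (T x) = T (κ x)
  skew : ∀ x y, h (T x) y = -h x (T y)

/-- The `i`-th chain is generated by a real vector, is normalised so that reversing its order gives
its dual chain, and is orthogonal to the other chains. -/
structure IsSelfDualChain (h : V →ₗ⋆[ℂ] V →ₗ[ℂ] ℂ) (κ : V →ₗ⋆[ℂ] V) (T : End ℂ V) {ι : Type*}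
    (τ : ι → ℂ) (d : ι → ℕ) (v : ι → V) (i : ι) : Prop where
  real : κ (v i) = v i
  norm_eq : ‖h (v i) ((T ^ (d i - 1)) (v i))‖ = 1
  self_eq_zero : ∀ j < d i - 1, h (v i) ((T ^ j) (v i)) = 0
  orthogonal : ∀ i', i' ≠ i → ∀ j k,
    h (v i) ((T ^ j) (((T - algebraMap ℂ (End ℂ V) (τ i')) ^ k) (v i'))) = 0

variable {h : V →ₗ⋆[ℂ] V →ₗ[ℂ] ℂ} {κ : V →ₗ⋆[ℂ] V} {T : End ℂ V}

/-- Vectors whose whole `T`-orbit is annihilated by `h x` form a `T`-invariant subspace, hence one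
invariant under `T - τ`. -/
theorem apply_pow_sub_eq_zero {x y : V} (hxy : ∀ j, h x ((T ^ j) y) = 0) (τ : ℂ) (j k : ℕ) :
    h x ((T ^ j) (((T - algebraMap ℂ (End ℂ V) τ) ^ k) y)) = 0 := by
  have hy : y ∈ chainCompl T (h x) ⊤ := mem_chainCompl.2 ⟨trivial, hxy⟩
  have hT := chainCompl_invariant (g := T) (φ := h x) (W := ⊤) (by simp)
  exact (mem_chainCompl.1
    (pow_apply_mem (fun z hz => sub_algebraMap_apply_mem hT τ hz) k hy)).2 j

theorem IsSelfDualChain.inl {ι ι' : Type*} {τ : ι → ℂ} {d : ι → ℕ} {v : ι → V}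
    {τ' : ι' → ℂ} {d' : ι' → ℕ} {v' : ι' → V} {i : ι} (hi : IsSelfDualChain h κ T τ d v i)
    (ho : ∀ i' j, h (v i) ((T ^ j) (v' i')) = 0) :
    IsSelfDualChain h κ T (Sum.elim τ τ') (Sum.elim d d') (Sum.elim v v') (Sum.inl i) where
  real := hi.real
  norm_eq := hi.norm_eq
  self_eq_zero := hi.self_eq_zero
  orthogonal := by
    rintro (i' | i') hne j k
    · exact hi.orthogonal i' (fun e => hne (e ▸ rfl)) j k
    · exact apply_pow_sub_eq_zero (ho i') _ j k

theorem IsSelfDualChain.inr {ι ι' : Type*} {τ : ι → ℂ} {d : ι → ℕ} {v : ι → V}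
    {τ' : ι' → ℂ} {d' : ι' → ℕ} {v' : ι' → V} {i : ι'} (hi : IsSelfDualChain h κ T τ' d' v' i)
    (ho : ∀ i' j, h (v' i) ((T ^ j) (v i')) = 0) :
    IsSelfDualChain h κ T (Sum.elim τ τ') (Sum.elim d d') (Sum.elim v v') (Sum.inr i) where
  real := hi.real
  norm_eq := hi.norm_eq
  self_eq_zero := hi.self_eq_zero
  orthogonal := by
    rintro (i' | i') hne j k
    · exact apply_pow_sub_eq_zero (ho i') _ j k
    · exact hi.orthogonal i' (fun e => hne (e ▸ rfl)) j k

theorem IsSelfDualChain.reindex {ι ι' : Type*} {τ : ι → ℂ} {d : ι → ℕ} {v : ι → V} (e : ι' ≃ ι)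
    {i : ι'} (hi : IsSelfDualChain h κ T τ d v (e i)) :
    IsSelfDualChain h κ T (τ ∘ e) (d ∘ e) (v ∘ e) i where
  real := hi.real
  norm_eq := hi.norm_eq
  self_eq_zero := hi.self_eq_zero
  orthogonal i' hne := hi.orthogonal (e i') (e.injective.ne hne)

namespace IsRealSkew

variable (H : IsRealSkew h κ T)

include H

theorem skew_pow (j : ℕ) (x y : V) : h ((T ^ j) x) y = (-1) ^ j * h x ((T ^ j) y) := by
  induction j generalizing y with
  | zero => simp
  | succ j ih =>
    have h1 : (T ^ (j + 1)) x = T ((T ^ j) x) := by rw [pow_succ', Module.End.mul_apply]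
    have h2 : (T ^ (j + 1)) y = (T ^ j) (T y) := by rw [pow_succ, Module.End.mul_apply]
    rw [h1, H.skew, ih, h2, pow_succ]
    ring

theorem comm_pow (j : ℕ) (x : V) : κ ((T ^ j) x) = (T ^ j) (κ x) := by
  induction j with
  | zero => simp
  | succ j ih => rw [pow_succ', Module.End.mul_apply, H.comm, ih, Module.End.mul_apply]

theorem conj_apply {x y : V} (hx : κ x = x) (hy : κ y = y) (j : ℕ) :
    conj (h x ((T ^ j) y)) = -h x ((T ^ j) y) := by
  have := H.conj_conj x ((T ^ j) y)
  rw [hx, H.comm_pow, hy] at this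
  rw [this, map_neg, Complex.conj_conj, ← this]

/-- Hermitian symmetry, skewness of `T` and the purely imaginary values of `h` on real vectors each
contribute a sign. The resulting parity in `j` separates even from odd chains. -/
theorem swap {x y : V} (hx : κ x = x) (hy : κ y = y) (j : ℕ) :
    h y ((T ^ j) x) = (-1) ^ (j + 1) * h x ((T ^ j) y) := by
  rw [H.symm, H.skew_pow, map_mul, H.conj_apply hx hy, pow_succ]
  simp

theorem orthogonal_symm {x y : V} (hxy : ∀ j, h x ((T ^ j) y) = 0) (j : ℕ) :
    h y ((T ^ j) x) = 0 := by
  rw [H.symm, H.skew_pow, hxy]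
  simp

theorem exists_real_decomposition {W : Submodule ℂ V} (hκ : ∀ x ∈ W, κ x ∈ W) {x : V}
    (hx : x ∈ W) :
    ∃ a ∈ W, ∃ b ∈ W, κ a = a ∧ κ b = b ∧ x = a + Complex.I • b := by
  refine ⟨(1 / 2 : ℂ) • (x + κ x), W.smul_mem _ (W.add_mem hx (hκ x hx)),
    (-Complex.I / 2 : ℂ) • (x - κ x), W.smul_mem _ (W.sub_mem hx (hκ x hx)), ?_, ?_, ?_⟩
  · simp [LinearMap.map_smulₛₗ, H.invol, Complex.conj_ofNat, add_comm]
  · rw [LinearMap.map_smulₛₗ, map_sub, H.invol, ← neg_sub x (κ x), smul_neg, ← neg_smul]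
    simp [neg_div, Complex.conj_ofNat]
  · rw [smul_smul, show Complex.I * (-Complex.I / 2) = 1 / 2 by
      rw [mul_div_assoc', mul_neg, Complex.I_mul_I, neg_neg], ← smul_add,
      show x + κ x + (x - κ x) = (2 : ℂ) • x by rw [two_smul]; abel, smul_smul]
    norm_num

theorem exists_real_ne_zero {W : Submodule ℂ V} (hκ : ∀ x ∈ W, κ x ∈ W) {x y : V} (hx : x ∈ W)
    (hy : y ∈ W) {j : ℕ} (hxy : h x ((T ^ j) y) ≠ 0) :
    ∃ a ∈ W, ∃ b ∈ W, κ a = a ∧ κ b = b ∧ h a ((T ^ j) b) ≠ 0 := by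
  by_contra! hcon
  obtain ⟨a, ha, b, hb, ha', hb', rfl⟩ := H.exists_real_decomposition hκ hx
  obtain ⟨c, hc, e, he, hc', he', rfl⟩ := H.exists_real_decomposition hκ hy
  apply hxy
  simp [LinearMap.map_smulₛₗ, hcon a ha c hc ha' hc', hcon a ha e he ha' he',
    hcon b hb c hc hb' hc', hcon b hb e he hb' he']

theorem conj_mem_chainCompl {W : Submodule ℂ V} (hκ : ∀ x ∈ W, κ x ∈ W) {v : V} (hv : κ v = v) :
    ∀ x ∈ chainCompl T (h v) W, κ x ∈ chainCompl T (h v) W := by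
  intro x hx
  rw [mem_chainCompl] at hx ⊢
  refine ⟨hκ x hx.1, fun j => ?_⟩
  have := H.conj_conj v ((T ^ j) x)
  rwa [hv, H.comm_pow, hx.2, map_zero, neg_zero] at this

/-- For odd `j` the pairing is symmetric on real vectors, so polarization applies: if it vanished on
`a`, `b` and `a + b`, it would vanish on the pair `a, b`. -/
theorem exists_real_self_ne_zero {W : Submodule ℂ V} (hκ : ∀ x ∈ W, κ x ∈ W) {x y : V}
    (hx : x ∈ W) (hy : y ∈ W) {j : ℕ} (hj : Odd j) (hxy : h x ((T ^ j) y) ≠ 0) :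
    ∃ a ∈ W, κ a = a ∧ h a ((T ^ j) a) ≠ 0 := by
  obtain ⟨a, ha, b, hb, ha', hb', hab⟩ := H.exists_real_ne_zero hκ hx hy hxy
  by_contra! hcon
  have h1 := hcon a ha ha'
  have h2 := hcon b hb hb'
  have h3 := hcon (a + b) (W.add_mem ha hb) (by rw [map_add, ha', hb'])
  have h4 := H.swap ha' hb' j
  rw [hj.add_one.neg_one_pow, one_mul] at h4
  simp only [map_add, LinearMap.add_apply, h1, h2, h4] at h3
  exact hab (by linear_combination h3 / 2)

/-- A real vector can be modified so that the form vanishes on all pairs from its Jordan chain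
that do not add up to the maximal degree. -/
theorem exists_real_antidiagonal {W : Submodule ℂ V} (hT : ∀ x ∈ W, T x ∈ W) {D : ℕ} (hD : Odd D)
    (hnil : ∀ x ∈ W, (T ^ (D + 1)) x = 0) {v : V} (hv : v ∈ W) (hv' : κ v = v)
    (hvD : h v ((T ^ D) v) ≠ 0) (m : ℕ) :
    ∃ w ∈ W, κ w = w ∧ h w ((T ^ D) w) ≠ 0 ∧
      ∀ j, j < D → D ≤ j + m → h w ((T ^ j) w) = 0 := by
  induction m with
  | zero => exact ⟨v, hv, hv', hvD, fun j h1 h2 => by omega⟩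
  | succ m ih =>
    obtain ⟨w, hw, hw', hwD, hwj⟩ := ih
    have hz : ∀ j, D < j → (T ^ j) w = 0 := fun j hj => pow_apply_eq_zero_of_le (hnil w hw) hj
    by_cases hm : m + 1 ≤ D
    swap
    · exact ⟨w, hw, hw', hwD, fun j h1 h2 => hwj j h1 (by omega)⟩
    rcases Nat.even_or_odd (m + 1) with he | ho
    -- Since `m + 1` is even, the two cross terms of the corrected vector agree. This `a` cancels
    -- the pairing of degree `D - (m + 1)`; it is real as a quotient of imaginary numbers. Higher
    -- degrees are unaffected because `T ^ j w = 0` for `j > D`.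
    · set a : ℂ := -(h w ((T ^ (D - (m + 1))) w)) / (2 * h w ((T ^ D) w)) with ha
      have ha' : conj a = a := by
        simp only [ha, map_div₀, map_neg, map_mul, H.conj_apply hw' hw', Complex.conj_ofNat]
        field_simp
      have key : ∀ j, h (w + a • (T ^ (m + 1)) w) ((T ^ j) (w + a • (T ^ (m + 1)) w)) =
          h w ((T ^ j) w) + 2 * a * h w ((T ^ (j + (m + 1))) w) +
            a ^ 2 * h w ((T ^ (j + (m + 1) + (m + 1))) w) := by
        intro j
        simp only [map_add, map_smul, LinearMap.map_smulₛₗ, LinearMap.add_apply,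
          LinearMap.smul_apply, smul_eq_mul, ha', H.skew_pow, he.neg_one_pow,
          ← Module.End.mul_apply, ← pow_add, one_mul]
        rw [show m + 1 + j = j + (m + 1) by omega,
          show m + 1 + (j + (m + 1)) = j + (m + 1) + (m + 1) by omega]
        ring
      refine ⟨w + a • (T ^ (m + 1)) w, W.add_mem hw (W.smul_mem _ (pow_apply_mem hT _ hw)), ?_, ?_,
        fun j hj hjm => ?_⟩
      · rw [map_add, LinearMap.map_smulₛₗ, H.comm_pow, hw', ha']
      · rw [key, hz (D + (m + 1)) (by omega), hz (D + (m + 1) + (m + 1)) (by omega)]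
        simpa using hwD
      · rw [key, hz (j + (m + 1) + (m + 1)) (by omega)]
        rcases hjm.eq_or_lt with heq | hlt
        · have hj' : j = D - (m + 1) := by omega
          rw [← heq, hj', ha]
          simp only [map_zero, mul_zero, add_zero]
          field_simp
          ring
        · rw [hz _ hlt, hwj j hj (by omega)]
          simp
    -- With `D` and `m + 1` odd the new degree is even, where self-pairings vanish automatically.
    · refine ⟨w, hw, hw', hwD, fun j hj hjm => ?_⟩
      rcases hjm.eq_or_lt with heq | hlt
      · have hje : Even j := by
          rw [heq] at hD
          exact (Nat.odd_add'.1 hD).1 ho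
        have := H.swap hw' hw' j
        rw [hje.add_one.neg_one_pow] at this
        linear_combination this / 2
      · exact hwj j hj (by omega)

theorem exists_selfDual_generator {W : Submodule ℂ V} (hT : ∀ x ∈ W, T x ∈ W) {D : ℕ} (hD : Odd D)
    (hnil : ∀ x ∈ W, (T ^ (D + 1)) x = 0) {v : V} (hv : v ∈ W) (hv' : κ v = v)
    (hvD : h v ((T ^ D) v) ≠ 0) :
    ∃ w ∈ W, κ w = w ∧ ‖h w ((T ^ D) w)‖ = 1 ∧ ∀ j < D, h w ((T ^ j) w) = 0 := by
  obtain ⟨w, hw, hw', hwD, hwj⟩ := H.exists_real_antidiagonal hT hD hnil hv hv' hvD D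
  set q := ‖h w ((T ^ D) w)‖ with hq
  have hq0 : 0 < q := norm_pos_iff.2 hwD
  have key : ∀ j, h (((1 / √q : ℝ) : ℂ) • w) ((T ^ j) (((1 / √q : ℝ) : ℂ) • w)) =
      ((1 / q : ℝ) : ℂ) * h w ((T ^ j) w) := by
    intro j
    simp only [map_smul, LinearMap.map_smulₛₗ, LinearMap.smul_apply, smul_eq_mul,
      Complex.conj_ofReal]
    rw [← mul_assoc, ← Complex.ofReal_mul, div_mul_div_comm, Real.mul_self_sqrt hq0.le, one_mul]
  refine ⟨((1 / √q : ℝ) : ℂ) • w, W.smul_mem _ hw, ?_, ?_, fun j hj => ?_⟩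
  · rw [LinearMap.map_smulₛₗ, hw', Complex.conj_ofReal]
  · rw [key, norm_mul, ← hq, Complex.norm_real, Real.norm_of_nonneg (by positivity)]
    field_simp
  · rw [key, hwj j hj (by omega), mul_zero]

end IsRealSkew

end RealSkew

/-! ### Normal form on the nilpotent part, and the Fitting decomposition -/

section Nilpotent

variable {V : Type*} [AddCommGroup V] [Module ℂ V]
  {h : V →ₗ⋆[ℂ] V →ₗ[ℂ] ℂ} {κ : V →ₗ⋆[ℂ] V} {T : End ℂ V}

theorem isChainBasis_chain_zero {K V : Type*} [Field K] [AddCommGroup V] [Module K V]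
    {T : End K V} {φ : V →ₗ[K] K} {v : V} {d : ℕ} (hd : 0 < d) (hv : (T ^ d) v = 0)
    (hφ : φ ((T ^ (d - 1)) v) ≠ 0) :
    IsChainBasis T (Submodule.span K (Set.range fun k : Fin d => (T ^ (k : ℕ)) v))
      (fun _ : Unit => 0) (fun _ => d) (fun _ => v) := by
  have := isChainBasis_chain (T := T) (τ := 0) (φ := φ) (v := v) hd (by simpa using hv)
    (by simpa using hφ)
  simpa using this

theorem sum_elim_zero {ι ι' : Type*} :
    Sum.elim (fun _ : ι => (0 : ℂ)) (fun _ : ι' => (0 : ℂ)) = fun _ => 0 := by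
  funext i
  cases i <;> rfl

namespace IsRealSkew

variable (H : IsRealSkew h κ T)

include H

theorem apply_span_chain {v x : V} {d : ℕ} (hx : ∀ j, h v ((T ^ j) x) = 0) {y : V}
    (hy : y ∈ Submodule.span ℂ (Set.range fun k : Fin d => (T ^ (k : ℕ)) v)) : h x y = 0 := by
  have : Submodule.span ℂ (Set.range fun k : Fin d => (T ^ (k : ℕ)) v) ≤ LinearMap.ker (h x) := by
    refine Submodule.span_le.2 ?_
    rintro _ ⟨k, rfl⟩
    exact H.orthogonal_symm hx k
  exact this hy

/-- The canonical form of a nilpotent Hamiltonian operator: the Jordan chains of even length can be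
chosen real, normalised and orthogonal to all other chains. -/
theorem exists_isChainBasis_nilpotent [FiniteDimensional ℂ V] (W : Submodule ℂ V)
    (hT : ∀ x ∈ W, T x ∈ W) (hκ : ∀ x ∈ W, κ x ∈ W)
    (hnd : ∀ x ∈ W, (∀ y ∈ W, h x y = 0) → x = 0) (hnil : ∃ n, ∀ x ∈ W, (T ^ n) x = 0) :
    ∃ (ι : Type) (_ : Fintype ι) (d : ι → ℕ) (v : ι → V),
      IsChainBasis T W (fun _ => 0) d v ∧
        ∀ i, Even (d i) → IsSelfDualChain h κ T (fun _ => 0) d v i := by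
  induction hn : Module.finrank ℂ W using Nat.strong_induction_on generalizing W with
  | _ n ih =>
    subst hn
    rcases eq_or_ne W ⊥ with rfl | hne
    · exact ⟨Empty, inferInstance, Empty.elim, Empty.elim, isChainBasis_bot T _ _ _,
        fun i => i.elim⟩
    classical
    obtain ⟨d, hd, hmin⟩ : ∃ d, (∀ x ∈ W, (T ^ d) x = 0) ∧
        ∀ m < d, ¬ ∀ x ∈ W, (T ^ m) x = 0 :=
      ⟨Nat.find hnil, Nat.find_spec hnil, fun m hm => Nat.find_min hnil hm⟩
    obtain ⟨D, rfl⟩ : ∃ D, d = D + 1 := by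
      refine Nat.exists_eq_succ_of_ne_zero ?_
      rintro rfl
      exact hne ((Submodule.eq_bot_iff _).2 fun x hx => by simpa using hd x hx)
    have h1 := hmin D (by omega)
    push Not at h1
    obtain ⟨y, hy, hyD⟩ := h1
    obtain ⟨x, hx, hxy⟩ : ∃ x ∈ W, h x ((T ^ D) y) ≠ 0 := by
      by_contra! hcon
      refine hyD (hnd _ (pow_apply_mem hT D hy) fun x hx => ?_)
      rw [H.symm, hcon x hx, map_zero]
    rcases Nat.even_or_odd D with hD | hD
    -- Odd length: the top pairing is alternating, so a chain cannot pair with itself at top degree,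
    -- and two real vectors paired with each other are used.
    · obtain ⟨w, hw, u, hu, hw', hu', hwu⟩ := H.exists_real_ne_zero hκ hx hy hxy
      have huu : h u ((T ^ D) u) = 0 := by
        have := H.swap hu' hu' D
        rw [hD.add_one.neg_one_pow] at this
        linear_combination this / 2
      have huw : h u ((T ^ D) w) ≠ 0 := by
        rw [H.swap hw' hu', hD.add_one.neg_one_pow]
        simpa using hwu
      have hφ₁ : h w ((T ^ (D + 1 - 1)) u) ≠ 0 := hwu
      have hsup₁ := chain_sup (hd u hu) hφ₁ hT hu fun x hx => by rw [hd x hx, map_zero]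
      have hdis₁ := chain_disjoint (hd u hu) hφ₁ W
      have hT₁ := chainCompl_invariant (φ := h w) hT
      have hκ₁ := H.conj_mem_chainCompl hκ hw'
      set W₁ := chainCompl T (h w) W with hW₁
      set U := Submodule.span ℂ (Set.range fun k : Fin (D + 1) => (T ^ (k : ℕ)) u) with hU
      -- The second chain must start inside `W₁`, so `w` is replaced by its component `w₁`. The
      -- discarded part `p` has no top pairing with `u`. The complements are still cut out by the
      -- real vectors `w` and `u`, which keeps them stable under `κ`.
      obtain ⟨p, hp, w₁, hw₁, hpw⟩ := Submodule.mem_sup.1 (hsup₁.ge hw)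
      have hw₁W : w₁ ∈ W := (mem_chainCompl.1 hw₁).1
      have hup : h u ((T ^ D) p) = 0 := by
        have hle : U ≤ LinearMap.ker (h u ∘ₗ T ^ D) := by
          refine Submodule.span_le.2 ?_
          rintro _ ⟨k, rfl⟩
          rcases Nat.eq_zero_or_pos (k : ℕ) with hk | hk
          · simpa [hk] using huu
          · simp only [SetLike.mem_coe, LinearMap.mem_ker, LinearMap.comp_apply,
              ← Module.End.mul_apply, ← pow_add]
            rw [pow_apply_eq_zero_of_le (hd u hu) (by omega), map_zero]
        exact hle hp
      have hφ₂ : h u ((T ^ (D + 1 - 1)) w₁) ≠ 0 := by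
        rw [← hpw, map_add, map_add, hup, zero_add] at huw
        exact huw
      have hsup₂ := chain_sup (hd w₁ hw₁W) hφ₂ hT₁ hw₁
        fun x hx => by rw [hd x (mem_chainCompl.1 hx).1, map_zero]
      have hdis₂ := chain_disjoint (hd w₁ hw₁W) hφ₂ W₁
      have hT₂ := chainCompl_invariant (φ := h u) hT₁
      have hκ₂ := H.conj_mem_chainCompl hκ₁ hu'
      have hlt := (finrank_chainCompl_lt hw₁ hφ₂).trans (finrank_chainCompl_lt hu hφ₁)
      set W₂ := chainCompl T (h u) W₁ with hW₂
      have hperp : ∀ z ∈ W₂, (∀ j, h w ((T ^ j) z) = 0) ∧ (∀ j, h u ((T ^ j) z) = 0) ∧ z ∈ W := by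
        intro z hz
        obtain ⟨h2, h3⟩ := mem_chainCompl.1 hz
        obtain ⟨h4, h5⟩ := mem_chainCompl.1 h2
        exact ⟨h5, h3, h4⟩
      have hperp₁ : ∀ z ∈ W₂, ∀ j, h z ((T ^ j) w₁) = 0 := by
        intro z hz j
        have h2 := H.orthogonal_symm (hperp z hz).1 j
        have h3 : h z ((T ^ j) p) = 0 := by
          have hle : U ≤ LinearMap.ker (h z ∘ₗ T ^ j) := by
            refine Submodule.span_le.2 ?_
            rintro _ ⟨k, rfl⟩
            simp only [SetLike.mem_coe, LinearMap.mem_ker, LinearMap.comp_apply,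
              ← Module.End.mul_apply, ← pow_add]
            exact H.orthogonal_symm (hperp z hz).2.1 _
          exact hle hp
        rwa [← hpw, map_add, map_add, h3, zero_add] at h2
      -- `W₂` is orthogonal to both removed chains, which together with it span `W`; nondegeneracy
      -- is therefore inherited.
      have hnd₂ : ∀ z ∈ W₂, (∀ y ∈ W₂, h z y = 0) → z = 0 := by
        intro z hz hzy
        refine hnd z (hperp z hz).2.2 fun y hy => ?_
        obtain ⟨y₁, hy₁, y', hy', rfl⟩ := Submodule.mem_sup.1 (hsup₁.ge hy)
        obtain ⟨y₂, hy₂, y₃, hy₃, rfl⟩ := Submodule.mem_sup.1 (hsup₂.ge hy')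
        rw [map_add, map_add, H.apply_span_chain (hperp z hz).2.1 hy₁, hzy _ hy₃,
          H.apply_span_chain (H.orthogonal_symm (hperp₁ z hz)) hy₂, add_zero, add_zero]
      obtain ⟨ι, _, d', v', hb, hsd⟩ := ih _ hlt W₂ hT₂ hκ₂ hnd₂
        ⟨D + 1, fun z hz => hd z (hperp z hz).2.2⟩ rfl
      have hb₂ := (isChainBasis_chain_zero (Nat.succ_pos D) (hd w₁ hw₁W) hφ₂).sum hb hdis₂
      rw [hsup₂] at hb₂
      have hb₁ := (isChainBasis_chain_zero (Nat.succ_pos D) (hd u hu) hφ₁).sum hb₂ hdis₁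
      rw [hsup₁, sum_elim_zero, sum_elim_zero] at hb₁
      refine ⟨_, inferInstance, _, _, hb₁, ?_⟩
      rintro (i | i | i) hi
      · exact absurd hi (Nat.not_even_iff_odd.2 hD.add_one)
      · exact absurd hi (Nat.not_even_iff_odd.2 hD.add_one)
      · have h2 := (hsd i hi).inr (τ := fun _ : Unit => 0) (d := fun _ => D + 1)
          (v := fun _ => w₁) fun _ j => hperp₁ _ (hb.mem i) j
        have h3 := h2.inr (τ := fun _ : Unit => 0) (d := fun _ => D + 1)
          (v := fun _ => u) fun _ j => H.orthogonal_symm (hperp _ (hb.mem i)).2.1 j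
        rwa [sum_elim_zero, sum_elim_zero] at h3
    -- Even length: the top pairing is symmetric, and a single self-paired chain splits off
    -- orthogonally.
    · obtain ⟨a, ha, ha', haD⟩ := H.exists_real_self_ne_zero hκ hx hy hD hxy
      obtain ⟨w, hw, hw', hw1, hwj⟩ := H.exists_selfDual_generator hT hD hd ha ha' haD
      have hφ : h w ((T ^ (D + 1 - 1)) w) ≠ 0 := by
        rw [Nat.add_sub_cancel, ← norm_ne_zero_iff, hw1]
        exact one_ne_zero
      have hsup := chain_sup (hd w hw) hφ hT hw fun x hx => by rw [hd x hx, map_zero]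
      have hdis := chain_disjoint (hd w hw) hφ W
      have hnd' : ∀ z ∈ chainCompl T (h w) W, (∀ y ∈ chainCompl T (h w) W, h z y = 0) → z = 0 := by
        intro z hz hzy
        obtain ⟨hzW, hz'⟩ := mem_chainCompl.1 hz
        refine hnd z hzW fun y hy => ?_
        obtain ⟨y₁, hy₁, y₂, hy₂, rfl⟩ := Submodule.mem_sup.1 (hsup.ge hy)
        rw [map_add, H.apply_span_chain hz' hy₁, hzy _ hy₂, add_zero]
      obtain ⟨ι, _, d', v', hb, hsd⟩ := ih _ (finrank_chainCompl_lt hw hφ) _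
        (chainCompl_invariant (φ := h w) hT) (H.conj_mem_chainCompl hκ hw') hnd'
        ⟨D + 1, fun z hz => hd z (mem_chainCompl.1 hz).1⟩ rfl
      have hb' := (isChainBasis_chain_zero (Nat.succ_pos D) (hd w hw) hφ).sum hb hdis
      rw [hsup, sum_elim_zero] at hb'
      refine ⟨_, inferInstance, _, _, hb', ?_⟩
      have horth : ∀ i j, h w ((T ^ j) (v' i)) = 0 := fun i =>
        (mem_chainCompl.1 (hb.mem i)).2
      rintro (i | i) hi
      · have hself : IsSelfDualChain h κ T (fun _ : Unit => 0) (fun _ => D + 1) (fun _ => w) i :=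
          ⟨hw', hw1, hwj, fun _ hne => absurd rfl hne⟩
        have h2 := hself.inl (τ' := fun _ : ι => 0) (d' := d') (v' := v') horth
        rwa [sum_elim_zero] at h2
      · have h2 := (hsd i hi).inr (τ := fun _ : Unit => 0) (d := fun _ => D + 1)
          (v := fun _ => w) fun _ j => H.orthogonal_symm (horth i) j
        rwa [sum_elim_zero] at h2

/-- A Jordan basis of a Hamiltonian operator in which the chains of even length with null
eigenvalue are self-dual. -/
theorem exists_isChainBasis_selfDual [FiniteDimensional ℂ V]
    (hnd : ∀ x, (∀ y, h x y = 0) → x = 0) :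
    ∃ (ι : Type) (_ : Fintype ι) (τ : ι → ℂ) (d : ι → ℕ) (v : ι → V),
      IsChainBasis T ⊤ τ d v ∧
        ∀ i, τ i = 0 → Even (d i) → IsSelfDualChain h κ T τ d v i := by
  -- The bound `1 ≤ N` ensures that `T ^ N` kills the last vector of any chain at eigenvalue zero,
  -- which excludes such chains from the range.
  obtain ⟨N, hN, hN1⟩ :=
    (T.eventually_isCompl_ker_pow_range_pow.and (Filter.eventually_ge_atTop 1)).exists
  have hcomm : ∀ x, (T ^ N) (T x) = T ((T ^ N) x) := fun x => by
    rw [← Module.End.mul_apply, ← Module.End.mul_apply, ← pow_succ, ← pow_succ']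
  obtain ⟨ι, _, d, v, hb, hsd⟩ := H.exists_isChainBasis_nilpotent (LinearMap.ker (T ^ N))
    (fun x hx => by rw [LinearMap.mem_ker, hcomm, LinearMap.mem_ker.1 hx, map_zero])
    (fun x hx => by rw [LinearMap.mem_ker, ← H.comm_pow, LinearMap.mem_ker.1 hx, map_zero])
    (fun x hx hxy => hnd x fun y => by
      obtain ⟨y₁, hy₁, _, ⟨z, rfl⟩, rfl⟩ := Submodule.mem_sup.1 (hN.sup_eq_top.ge (trivial : y ∈ ⊤))
      have := H.skew_pow N x z
      rw [LinearMap.mem_ker.1 hx, map_zero, LinearMap.zero_apply] at this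
      rw [map_add, hxy _ hy₁, zero_add]
      exact (mul_eq_zero.1 this.symm).resolve_left (by simp))
    ⟨N, fun x hx => hx⟩
  have hTr : ∀ x ∈ LinearMap.range (T ^ N), T x ∈ LinearMap.range (T ^ N) := by
    rintro _ ⟨x, rfl⟩
    exact ⟨T x, hcomm x⟩
  obtain ⟨ι', _, τ', d', v', hb'⟩ := exists_isChainBasis T (LinearMap.range (T ^ N)) hTr
  have hτ' : ∀ i, τ' i ≠ 0 := by
    intro i hi
    have h0 := hb'.ne_zero i (Nat.sub_lt (hb'.pos i) one_pos)
    have h1 := hb'.pow_eq_zero i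
    rw [hi, map_zero, sub_zero] at h0 h1
    refine h0 (Submodule.disjoint_def.1 hN.disjoint _ ?_ (pow_apply_mem hTr _ (hb'.mem i)))
    rw [LinearMap.mem_ker, ← Module.End.mul_apply, ← pow_add]
    exact pow_apply_eq_zero_of_le h1 (by omega)
  have hsum := hb.sum hb' hN.disjoint
  rw [hN.sup_eq_top] at hsum
  refine ⟨_, inferInstance, _, _, _, hsum, ?_⟩
  rintro (i | i) hi hev
  · refine (hsd i hev).inl fun i' j => ?_
    obtain ⟨z, hz⟩ := pow_apply_mem hTr j (hb'.mem i')
    have := H.skew_pow N (v i) z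
    rw [LinearMap.mem_ker.1 (hb.mem i), map_zero, LinearMap.zero_apply] at this
    rw [← hz]
    exact (mul_eq_zero.1 this.symm).resolve_left (by simp)
  · exact absurd hi (hτ' i)

end IsRealSkew

end Nilpotent

end Module.End

/-! ### Translation between `N S` and the abstract Hamiltonian operator -/

namespace RPA

open scoped ComplexConjugate

open Module.End

variable {n : Type*}

theorem normMatrix_mul_self [Fintype n] [DecidableEq n] : normMatrix n * normMatrix n = 1 := by
  simp [normMatrix, Matrix.fromBlocks_multiply, Matrix.fromBlocks_one]

theorem normMatrix_conjTranspose [DecidableEq n] : (normMatrix n)ᴴ = normMatrix n := by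
  simp [normMatrix, Matrix.fromBlocks_conjTranspose]

theorem normMatrix_map_conj [DecidableEq n] : (normMatrix n).map conj = normMatrix n := by
  ext i j
  rcases i with i | i <;> rcases j with j | j <;>
    simp [normMatrix, Matrix.one_apply, apply_ite]

theorem sigmaX_map_conj [DecidableEq n] : (sigmaX n).map conj = sigmaX n := by
  ext i j
  rcases i with i | i <;> rcases j with j | j <;>
    simp [sigmaX, Matrix.one_apply, apply_ite]

theorem sigmaX_conjTranspose [DecidableEq n] : (sigmaX n)ᴴ = sigmaX n := by
  simp [sigmaX, Matrix.fromBlocks_conjTranspose]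

theorem sigmaX_mul_self [Fintype n] [DecidableEq n] : sigmaX n * sigmaX n = 1 := by
  simp [sigmaX, Matrix.fromBlocks_multiply, Matrix.fromBlocks_one]

theorem sigmaX_mul_normMatrix [Fintype n] [DecidableEq n] :
    sigmaX n * normMatrix n = -(normMatrix n * sigmaX n) := by
  simp [sigmaX, normMatrix, Matrix.fromBlocks_multiply, Matrix.fromBlocks_neg]

theorem stabilityMatrix_isHermitian {A B : Matrix n n ℂ} (hA : A.IsHermitian) (hB : B.IsSymm) :
    (stabilityMatrix A B)ᴴ = stabilityMatrix A B := by
  have hA' : ∀ i j, conj (A i j) = A j i := fun i j => hA.apply j i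
  have hB' : ∀ i j, B i j = B j i := fun i j => hB.apply j i
  ext i j
  rcases i with i | i <;> rcases j with j | j <;>
    simp [stabilityMatrix, hA', hB' i j]

theorem sigmaX_mul_stabilityMatrix [Fintype n] [DecidableEq n] (A B : Matrix n n ℂ) :
    sigmaX n * (stabilityMatrix A B).map conj = stabilityMatrix A B * sigmaX n := by
  have h : ∀ M : Matrix n n ℂ, (M.map conj).map conj = M := fun M => by ext; simp
  simp [sigmaX, stabilityMatrix, Matrix.fromBlocks_multiply, Matrix.fromBlocks_map, h]

theorem star_mulVec_eq [Fintype n] (M : Matrix (n ⊕ n) (n ⊕ n) ℂ) (x : n ⊕ n → ℂ) :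
    star (M *ᵥ x) = M.map conj *ᵥ star x :=
  funext fun i => RingHom.map_mulVec conj M x i

theorem star_mulVec_dotProduct [Fintype n] {M : Matrix (n ⊕ n) (n ⊕ n) ℂ} (hM : Mᴴ = M)
    (x y : n ⊕ n → ℂ) :
    star (M *ᵥ x) ⬝ᵥ y = star x ⬝ᵥ (M *ᵥ y) := by
  rw [Matrix.star_mulVec, hM, Matrix.dotProduct_mulVec]

variable [Fintype n] [DecidableEq n]

/-- The overlap as a sesquilinear form. -/
def overlapForm (n : Type*) [Fintype n] [DecidableEq n] :
    (n ⊕ n → ℂ) →ₗ⋆[ℂ] (n ⊕ n → ℂ) →ₗ[ℂ] ℂ :=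
  LinearMap.mk₂'ₛₗ (starRingEnd ℂ) (RingHom.id ℂ) overlap
    (fun x y z => by simp [overlap, add_dotProduct])
    (fun a x y => by simp [overlap])
    (fun x y z => by simp [overlap, Matrix.mulVec_add, dotProduct_add])
    (fun a x y => by simp [overlap, Matrix.mulVec_smul])

/-- The antilinear involution `x ↦ -Σ_x x*`. -/
def negUlDual (n : Type*) [Fintype n] [DecidableEq n] : (n ⊕ n → ℂ) →ₗ⋆[ℂ] (n ⊕ n → ℂ) where
  toFun x := -ulDual x
  map_add' x y := by simp [ulDual, Matrix.mulVec_add, add_comm]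
  map_smul' a x := by simp [ulDual, Matrix.mulVec_smul]

/-- The operator `-i N S`. -/
def hamiltonian (A B : Matrix n n ℂ) : Module.End ℂ (n ⊕ n → ℂ) :=
  (-Complex.I) • (normMatrix n * stabilityMatrix A B).mulVecLin

theorem hamiltonian_apply (A B : Matrix n n ℂ) (x : n ⊕ n → ℂ) :
    hamiltonian A B x = (-Complex.I) • (normMatrix n *ᵥ (stabilityMatrix A B *ᵥ x)) := by
  simp [hamiltonian]

theorem stabilityMatrix_mulVec (A B : Matrix n n ℂ) (x : n ⊕ n → ℂ) :
    stabilityMatrix A B *ᵥ x = Complex.I • (normMatrix n *ᵥ hamiltonian A B x) := by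
  rw [hamiltonian_apply, Matrix.mulVec_smul, smul_smul, Matrix.mulVec_mulVec, normMatrix_mul_self]
  simp

/-- `N S` is self-adjoint for the overlap and anticommutes with `κ`, because `Σ_x` anticommutes with
`N`; the factor `-i` turns this into skewness and commutation. -/
theorem isRealSkew {A B : Matrix n n ℂ} (hA : A.IsHermitian) (hB : B.IsSymm) :
    IsRealSkew (overlapForm n) (negUlDual n) (hamiltonian A B) where
  symm x y := by
    change overlap y x = star (overlap x y)
    rw [overlap, overlap, ← Matrix.star_dotProduct,
      star_mulVec_dotProduct normMatrix_conjTranspose]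
  conj_conj x y := by
    change overlap (-ulDual x) (-ulDual y) = -star (overlap x y)
    have h1 : overlap (-ulDual x) (-ulDual y) = overlap (ulDual x) (ulDual y) := by
      simp [overlap, Matrix.mulVec_neg]
    rw [h1, overlap, overlap, ulDual, ulDual, star_mulVec_dotProduct sigmaX_conjTranspose,
      Matrix.mulVec_mulVec, Matrix.mulVec_mulVec, sigmaX_mul_normMatrix, neg_mul, mul_assoc,
      sigmaX_mul_self, mul_one, Matrix.neg_mulVec, dotProduct_neg, dotProduct_comm (star x),
      ← Matrix.star_dotProduct_star, star_mulVec_eq, normMatrix_map_conj, star_star,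
      dotProduct_comm]
  invol x := by
    change -ulDual (-ulDual x) = x
    simp only [ulDual, star_neg, star_mulVec_eq, sigmaX_map_conj, star_star, Matrix.mulVec_neg,
      Matrix.mulVec_mulVec, sigmaX_mul_self, Matrix.one_mulVec, neg_neg]
  comm x := by
    change -ulDual (hamiltonian A B x) = hamiltonian A B (-ulDual x)
    simp only [ulDual, hamiltonian_apply, star_smul, star_mulVec_eq, normMatrix_map_conj,
      Matrix.mulVec_neg, Matrix.mulVec_smul, Matrix.mulVec_mulVec (v := star _)]
    rw [← mul_assoc, sigmaX_mul_normMatrix, neg_mul, mul_assoc, sigmaX_mul_stabilityMatrix]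
    simp [Matrix.neg_mulVec]
  skew x y := by
    change overlap (hamiltonian A B x) y = -overlap x (hamiltonian A B y)
    have hN : ∀ z : n ⊕ n → ℂ, normMatrix n *ᵥ (normMatrix n *ᵥ z) = z := fun z => by
      rw [Matrix.mulVec_mulVec, normMatrix_mul_self, Matrix.one_mulVec]
    simp only [overlap, hamiltonian_apply, star_smul, Matrix.mulVec_smul, smul_dotProduct,
      dotProduct_smul, star_mulVec_dotProduct normMatrix_conjTranspose,
      star_mulVec_dotProduct (stabilityMatrix_isHermitian hA hB), hN]
    simp

theorem overlapForm_nondegenerate (x : n ⊕ n → ℂ) (hx : ∀ y, overlapForm n x y = 0) : x = 0 := by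
  have h : ∀ y, star x ⬝ᵥ y = 0 := fun y => by
    have := hx (normMatrix n *ᵥ y)
    change star x ⬝ᵥ (normMatrix n *ᵥ (normMatrix n *ᵥ y)) = 0 at this
    rwa [Matrix.mulVec_mulVec, normMatrix_mul_self, Matrix.one_mulVec] at this
  exact star_eq_zero.1 (dotProduct_eq_zero _ h)

variable {A B : Matrix n n ℂ} {m : ℕ} {ω : Fin m → ℂ} {d : Fin m → ℕ}

/-- Since `S = i N T`, one has `S x = ω N x + i N (T - τ) x` with `τ = -i ω`. Chains are listed from
their generator downwards, so the order is reversed, and all constants `c` are `1`. -/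
theorem exists_jordanBasis {τ : Fin m → ℂ} (hτ : ∀ ν, τ ν = -Complex.I * ω ν)
    {v : Fin m → n ⊕ n → ℂ} (h : IsChainBasis (hamiltonian A B) ⊤ τ d v) :
    ∃ J : JordanBasis A B ω d, ∀ ν k, J.basis ⟨ν, k⟩ =
      ((hamiltonian A B - algebraMap ℂ (Module.End ℂ (n ⊕ n → ℂ)) (τ ν)) ^ (d ν - (k + 1)))
        (v ν) := by
  let b := (Module.Basis.mk h.linearIndependent h.span_eq.ge).reindex
    (Equiv.sigmaCongrRight fun ν => (Fin.revPerm : Equiv.Perm (Fin (d ν))))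
  have hb : ∀ ν k, b ⟨ν, k⟩ =
      ((hamiltonian A B - algebraMap ℂ (Module.End ℂ (n ⊕ n → ℂ)) (τ ν)) ^ (d ν - (k + 1)))
        (v ν) := fun ν k => by
    simp [b, chainFamily, Equiv.sigmaCongrRight]
  have hS : ∀ ν x, stabilityMatrix A B *ᵥ x = ω ν • (normMatrix n *ᵥ x) + Complex.I •
      (normMatrix n *ᵥ
        (hamiltonian A B - algebraMap ℂ (Module.End ℂ (n ⊕ n → ℂ)) (τ ν)) x) := by
    intro ν x
    rw [stabilityMatrix_mulVec, LinearMap.sub_apply, Module.algebraMap_end_apply, hτ,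
      Matrix.mulVec_sub, smul_sub, Matrix.mulVec_smul, smul_smul, ← mul_assoc]
    simp
  refine ⟨⟨b, fun _ _ => 1, h.pos, fun _ _ _ => one_ne_zero, fun ν => ?_, fun ν k hk => ?_⟩, hb⟩
  · rw [hS ν, hb, ← Module.End.mul_apply, ← pow_succ', zero_add, Nat.sub_add_cancel (h.pos ν),
      h.pow_eq_zero]
    simp
  · have := hb ν ⟨k, Nat.lt_of_succ_lt hk⟩
    rw [hS ν, hb ν ⟨k + 1, hk⟩, ← Module.End.mul_apply, ← pow_succ',
      show d ν - (k + 1 + 1) + 1 = d ν - (k + 1) by omega, this, mul_one]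

/-- The last vector of each block generates it: powers of `T - τ` give the earlier vectors up to
products of the nonzero `c`, and such rescaling preserves independence. -/
theorem JordanBasis.isChainBasis (J : JordanBasis A B ω d) :
    IsChainBasis (hamiltonian A B) ⊤ (fun ν => -Complex.I * ω ν) d
      (fun ν => J.basis ⟨ν, Fin.rev ⟨0, J.dim_pos ν⟩⟩) := by
  have hT : ∀ ν x y, stabilityMatrix A B *ᵥ x = ω ν • (normMatrix n *ᵥ x) +
      Complex.I • (normMatrix n *ᵥ y) →
      (hamiltonian A B - algebraMap ℂ (Module.End ℂ (n ⊕ n → ℂ)) (-Complex.I * ω ν)) x = y := by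
    intro ν x y hxy
    rw [LinearMap.sub_apply, Module.algebraMap_end_apply, hamiltonian_apply, hxy, Matrix.mulVec_add,
      Matrix.mulVec_smul, Matrix.mulVec_smul, Matrix.mulVec_mulVec, Matrix.mulVec_mulVec,
      normMatrix_mul_self, Matrix.one_mulVec, Matrix.one_mulVec, smul_add, smul_smul, smul_smul]
    simp
  have hpow : ∀ ν (k : ℕ) (hk : k < d ν), ∃ a : ℂ, a ≠ 0 ∧
      ((hamiltonian A B - algebraMap ℂ (Module.End ℂ (n ⊕ n → ℂ)) (-Complex.I * ω ν)) ^ k)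
        (J.basis ⟨ν, Fin.rev ⟨0, J.dim_pos ν⟩⟩) = a • J.basis ⟨ν, Fin.rev ⟨k, hk⟩⟩ := by
    intro ν k
    induction k with
    | zero => exact fun hk => ⟨1, one_ne_zero, by simp⟩
    | succ k ih =>
      intro hk
      obtain ⟨a, ha, hak⟩ := ih (by omega)
      have hlt : d ν - (k + 2) + 1 < d ν := by omega
      have hc := J.chain ν (d ν - (k + 2)) hlt
      have e1 : (⟨d ν - (k + 2) + 1, hlt⟩ : Fin (d ν)) = Fin.rev ⟨k, by omega⟩ := by
        ext; simp only [Fin.val_rev]; omega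
      have e2 : (⟨d ν - (k + 2), by omega⟩ : Fin (d ν)) = Fin.rev ⟨k + 1, hk⟩ := by
        ext; simp only [Fin.val_rev]
      rw [e1, e2, mul_smul, ← Matrix.mulVec_smul _ (J.c _ _)] at hc
      refine ⟨a * J.c ν (d ν - (k + 2)), mul_ne_zero ha (J.c_ne_zero _ _ hlt), ?_⟩
      rw [pow_succ', Module.End.mul_apply, hak, map_smul, hT ν _ _ hc, smul_smul]
  choose a ha hak using hpow
  have hli : LinearIndependent ℂ (chainFamily (hamiltonian A B) (fun ν => -Complex.I * ω ν) d
      (fun ν => J.basis ⟨ν, Fin.rev ⟨0, J.dim_pos ν⟩⟩)) := by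
    have h1 := (J.basis.linearIndependent.comp _ (Equiv.sigmaCongrRight fun ν =>
      (Fin.revPerm : Equiv.Perm (Fin (d ν)))).injective).units_smul
        fun p => Units.mk0 (a p.1 p.2 p.2.2) (ha p.1 p.2 p.2.2)
    convert h1 using 1
    funext ⟨ν, k, hk⟩
    exact hak ν k hk
  refine ⟨J.dim_pos, fun ν => ?_, hli, hli.span_eq_top_of_card_eq_finrank' ?_⟩
  · have hd : ∀ f : Module.End ℂ (n ⊕ n → ℂ), f ^ d ν = f * f ^ (d ν - 1) := fun f => by
      rw [← pow_succ', Nat.sub_add_cancel (J.dim_pos ν)]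
    have hlt : d ν - 1 < d ν := Nat.sub_lt (J.dim_pos ν) one_pos
    have e : Fin.rev (⟨d ν - 1, hlt⟩ : Fin (d ν)) = ⟨0, J.dim_pos ν⟩ := by
      ext; simp only [Fin.val_rev]; omega
    rw [hd, Module.End.mul_apply, hak ν (d ν - 1) hlt, map_smul, e, hT ν _ 0, smul_zero]
    rw [J.eigenvector]
    simp
  · rw [Module.finrank_eq_card_basis J.basis]

/-- Within the block, skewness reduces the overlap to `± h v (T ^ (k + d - 1 - k') v)`. This has
modulus one for `k' = k`, vanishes by nilpotency for `k' < k` and by `self_eq_zero` for `k' > k`. -/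
theorem isLRDual_rev (H : IsRealSkew (overlapForm n) (negUlDual n) (hamiltonian A B))
    {τ : Fin m → ℂ} {v : Fin m → n ⊕ n → ℂ} (h : IsChainBasis (hamiltonian A B) ⊤ τ d v)
    {J : JordanBasis A B ω d} (hJ : ∀ ν k, J.basis ⟨ν, k⟩ =
      ((hamiltonian A B - algebraMap ℂ (Module.End ℂ (n ⊕ n → ℂ)) (τ ν)) ^ (d ν - (k + 1))) (v ν))
    {ν : Fin m} (hν : τ ν = 0)
    (hsd : IsSelfDualChain (overlapForm n) (negUlDual n) (hamiltonian A B) τ d v ν)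
    (k : Fin (d ν)) : J.IsLRDual ν k (J.basis ⟨ν, Fin.rev k⟩) := by
  have hJν : ∀ k, J.basis ⟨ν, k⟩ = (hamiltonian A B ^ (d ν - (k + 1))) (v ν) := fun k => by
    rw [hJ, hν, map_zero, sub_zero]
  have hrev : J.basis ⟨ν, Fin.rev k⟩ = (hamiltonian A B ^ (k : ℕ)) (v ν) := by
    rw [hJν, Fin.val_rev, show d ν - (d ν - (k + 1) + 1) = k by omega]
  have hov : ∀ x, overlap (J.basis ⟨ν, Fin.rev k⟩) x =
      (-1) ^ (k : ℕ) * overlapForm n (v ν) ((hamiltonian A B ^ (k : ℕ)) x) := fun x => by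
    rw [hrev]
    exact H.skew_pow k (v ν) x
  have hnil := h.pow_eq_zero ν
  rw [hν, map_zero, sub_zero] at hnil
  refine ⟨?_, ?_⟩
  · rw [hov, hJν, ← Module.End.mul_apply, ← pow_add, show (k : ℕ) + (d ν - (k + 1)) = d ν - 1 by
      omega, norm_mul, hsd.norm_eq]
    simp
  · rintro ⟨ν', k'⟩ hne
    rw [hov]
    by_cases hνν : ν' = ν
    · subst hνν
      have hkk : (k' : ℕ) ≠ k := fun e => hne (by rw [Fin.ext e])
      rw [hJν, ← Module.End.mul_apply, ← pow_add]
      rcases lt_or_gt_of_ne hkk with hlt | hgt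
      · rw [pow_apply_eq_zero_of_le hnil (by omega), map_zero, mul_zero]
      · rw [hsd.self_eq_zero _ (by omega), mul_zero]
    · rw [hJ, hsd.orthogonal ν' hνν, mul_zero]

end RPA

theorem mainTheorem6 {n : Type*} [Fintype n] [DecidableEq n] (A B : Matrix n n ℂ)
    (hA : A.IsHermitian) (hB : B.IsSymm) :
    (∃ (m : ℕ) (ω : Fin m → ℂ) (d : Fin m → ℕ), Nonempty (RPA.JordanBasis A B ω d)) ∧
    ∀ (m : ℕ) (ω : Fin m → ℂ) (d : Fin m → ℕ), Nonempty (RPA.JordanBasis A B ω d) →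
      ∃ J : RPA.JordanBasis A B ω d, ∀ ν : Fin m, ω ν = 0 → Even (d ν) →
        (∀ k : Fin (d ν), RPA.ulDual (J.basis ⟨ν, k⟩) = -J.basis ⟨ν, k⟩) ∧
        (∀ k : Fin (d ν), J.IsLRDual ν k (J.basis ⟨ν, Fin.rev k⟩)) := by
  have H := RPA.isRealSkew hA hB
  obtain ⟨ι, _, τ, d₀, v, hb, hsd⟩ :=
    H.exists_isChainBasis_selfDual RPA.overlapForm_nondegenerate
  refine ⟨?_, ?_⟩
  · let e := (Fintype.equivFin ι).symm
    obtain ⟨J, -⟩ := RPA.exists_jordanBasis (ω := fun ν => Complex.I * τ (e ν))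
      (fun ν => by simp [← mul_assoc]) (hb.reindex e)
    exact ⟨_, _, _, ⟨J⟩⟩
  · rintro m ω d ⟨J₀⟩
    -- The given basis is used only for its block data, which must agree with those of the self-dual
    -- basis up to a permutation.
    obtain ⟨e, hτ, hd⟩ := J₀.isChainBasis.exists_equiv hb
    have hb' := hb.reindex e
    have hsd' := fun ν h1 h2 => (hsd (e ν) h1 h2).reindex e
    have hτ' : ∀ ν, τ (e ν) = -Complex.I * ω ν := fun ν => congrFun hτ ν
    have hd' : ∀ ν, d₀ (e ν) = d ν := fun ν => congrFun hd ν
    rw [hd] at hb'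
    simp only [hd, hd'] at hsd'
    obtain ⟨J, hJ⟩ := RPA.exists_jordanBasis hτ' hb'
    refine ⟨J, fun ν hν hev => ?_⟩
    have hτν : τ (e ν) = 0 := by rw [hτ', hν, mul_zero]
    have hs := hsd' ν hτν hev
    refine ⟨fun k => ?_, RPA.isLRDual_rev H hb' hJ hτν hs⟩
    -- A real generator makes its whole chain real, since `T` commutes with `κ`; being fixed by `κ`
    -- is the UL condition with its minus sign.
    have hk := H.comm_pow (d ν - (k + 1)) (v (e ν))
    have hreal : RPA.negUlDual n (v (e ν)) = v (e ν) := hs.real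
    rw [hreal] at hk
    have hJk := hJ ν k
    simp only [Function.comp_apply, hτν, map_zero, sub_zero] at hJk
    rw [hJk]
    exact neg_eq_iff_eq_neg.1 hk
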